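/- Let $k$ be a field, let $a_1,\dots,a_\ell>0$ be integers with $\gcd(a_1,\dots,a_\ell)=1$, let $H=\langle a_1,\dots,a_\ell\rangle\subseteq\mathbb{N}$ be the numerical semigroup they generate ($0\in H$), and let $A=k[[t^{a_1},\dots,t^{a_\ell}]]\subseteq k[[t]]$ be its semigroup ring, a one-dimensional Cohen–Macaulay local ring. A parameter ideal of a $d$-dimensional Noetherian local ring with maximal ideal $\mathfrak m$ is an $\mathfrak m$-primary ideal generated by $d$ elements. An $\mathfrak m$-primary ideal $I$ is an Ulrich ideal if it contains a parameter ideal $Q$ with $I^2=QI$ and $I/I^2$ is a free $A/I$-module. Let $\mathcal X_A^g$ be the set of Ulrich ideals of $A$ that are generated by monomials in $t$ and are not parameter ideals. A numerical semigroup $S$ with $F=\max(\mathbb Z\setminus S)$ is symmetric if for every $z\in\mathbb Z$ one has $z\in S$ if and only if $F-z\notin S$. **Theorem 6.4.** Suppose that $A$ is a Gorenstein ring, and let $I$ be an ideal of $A$. Then $I\in\mathcal X_A^g$ if and only if there are $a,b\in H$ with $a<b$ such that $I=(t^a,t^b)$ and, with $c=b-a$, 1. $c\notin H$ and $2c\in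 H$; 2. the numerical semigroup $H+\langle c\rangle$ is symmetric; 3. $a=\min\{h\in H : h+c\in H\}$. -/

import Mathlib

open scoped PowerSeries

/-! ### Local algebra -/

section LocalAlgebra

variable {A : Type*} [CommRing A] [IsLocalRing A]

/-- A parameter ideal of a (Noetherian) local ring `A` of Krull dimension `d`:
an ideal generated by `d` elements and primary to the maximal ideal. -/
def IsParameterIdeal (Q : Ideal A) : Prop :=
  ∃ (d : ℕ) (x : Fin d → A), ringKrullDim A = d ∧ Q = Ideal.span (Set.range x) ∧
    Q.radical = IsLocalRing.maximalIdeal A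

/-- Ulrich ideals: `I` is primary to the maximal ideal, it contains a parameter ideal `Q` with
`I ^ 2 = Q * I` (so that `Q` is a reduction of `I`), and `I / I ^ 2` is free over `A / I`. -/
structure IsUlrichIdeal (I : Ideal A) : Prop where
  radical_eq : I.radical = IsLocalRing.maximalIdeal A
  exists_reduction : ∃ Q : Ideal A, IsParameterIdeal Q ∧ Q ≤ I ∧ I ^ 2 = Q * I
  free : Module.Free (A ⧸ I) I.Cotangent

variable (A) in
/-- Gorenstein local rings: Noetherian local rings having a system of parameters that is a regular
sequence (i.e. Cohen-Macaulay local rings) and generates an irreducible ideal, which means that the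
Artinian quotient by it has a simple socle. -/
def IsGorensteinLocalRing : Prop :=
  IsNoetherianRing A ∧ ∃ x : List A, RingTheory.Sequence.IsRegular A x ∧
    (Ideal.ofList x).radical = IsLocalRing.maximalIdeal A ∧ InfIrred (Ideal.ofList x)

end LocalAlgebra

/-! ### Numerical semigroups and their rings -/

/-- The submonoid `⟨g₁, …, g_ℓ⟩` of `ℕ`. -/
def semigroupOf {ℓ : ℕ} (g : Fin ℓ → ℕ) : AddSubmonoid ℕ :=
  AddSubmonoid.closure (Set.range g)

/-- A numerical semigroup `H`, seen in `ℤ`, with Frobenius number `F = max (ℤ \ H)`, is symmetric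
if for every integer `z` exactly one of `z` and `F - z` lies in `H`. (For `H = ℕ`, `F = -1`.) -/
def IsSymmetricSemigroup (H : AddSubmonoid ℕ) : Prop :=
  ∃ F : ℤ, IsGreatest {z : ℤ | ¬ ∃ n ∈ H, (n : ℤ) = z} F ∧
    ∀ z : ℤ, (∃ n ∈ H, (n : ℤ) = z) ↔ ¬ ∃ n ∈ H, (n : ℤ) = F - z

/-- The semigroup ring `k[[H]] ⊆ k[[t]]` of the power series all of whose exponents lie in `H`.
For `H = ⟨g₁, …, g_ℓ⟩` these are the power series in `t ^ g₁, …, t ^ g_ℓ`, i.e. it is the ring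
`k[[t ^ g₁, …, t ^ g_ℓ]]`. -/
def semigroupRing (k : Type*) [Field k] (H : AddSubmonoid ℕ) : Subalgebra k k⟦X⟧ where
  carrier := {f | ∀ n, PowerSeries.coeff n f ≠ 0 → n ∈ H}
  mul_mem' := by
    intro f f' hf hf' n hn
    rw [PowerSeries.coeff_mul] at hn
    obtain ⟨p, hp, hne⟩ := Finset.exists_ne_zero_of_sum_ne_zero hn
    rw [← Finset.HasAntidiagonal.mem_antidiagonal.mp hp]
    exact H.add_mem (hf _ (left_ne_zero_of_mul hne)) (hf' _ (right_ne_zero_of_mul hne))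
  add_mem' := by
    intro f f' hf hf' n hn
    by_cases h : PowerSeries.coeff n f = 0
    · refine hf' n fun h' => hn ?_
      rw [map_add, h, h', add_zero]
    · exact hf n h
  algebraMap_mem' := by
    intro r n hn
    rw [PowerSeries.algebraMap_apply, PowerSeries.coeff_C] at hn
    by_cases h : n = 0
    · rw [h]
      exact H.zero_mem
    · simp [h] at hn

section SemigroupRing

variable {k : Type*} [Field k] {H : AddSubmonoid ℕ}

theorem X_pow_mem_semigroupRing {h : ℕ} (hh : h ∈ H) :
    (PowerSeries.X ^ h : k⟦X⟧) ∈ semigroupRing k H := by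
  intro n hn
  rw [PowerSeries.coeff_X_pow] at hn
  by_cases e : n = h
  · rwa [e]
  · simp [e] at hn

variable (k) in
/-- The monomial `t ^ h` of `k[[H]]`, for `h ∈ H`. -/
noncomputable def monomialOf (h : H) : semigroupRing k H :=
  ⟨PowerSeries.X ^ (h : ℕ), X_pow_mem_semigroupRing h.2⟩

theorem inv_mem_semigroupRing {f : k⟦X⟧} (hf : f ∈ semigroupRing k H) :
    f⁻¹ ∈ semigroupRing k H := by
  intro n
  induction n using Nat.strong_induction_on with
  | _ n ih =>
    intro hn
    by_contra hnH
    rw [PowerSeries.coeff_inv] at hn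
    have hn0 : n ≠ 0 := fun e => hnH (e ▸ H.zero_mem)
    rw [if_neg hn0] at hn
    obtain ⟨p, hp, hne⟩ := Finset.exists_ne_zero_of_sum_ne_zero (right_ne_zero_of_mul hn)
    split_ifs at hne with hlt
    · apply hnH
      rw [← Finset.HasAntidiagonal.mem_antidiagonal.mp hp]
      exact H.add_mem (hf _ (left_ne_zero_of_mul hne)) (ih _ hlt (right_ne_zero_of_mul hne))
    · exact hne rfl

instance semigroupRing_isLocalRing : IsLocalRing (semigroupRing k H) := by
  have : IsLocalHom (semigroupRing k H).val.toRingHom := by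
    refine ⟨fun f hf => ?_⟩
    have h0 : PowerSeries.constantCoeff (f : k⟦X⟧) ≠ 0 :=
      (PowerSeries.isUnit_iff_constantCoeff.mp hf).ne_zero
    refine IsUnit.of_mul_eq_one ⟨(f : k⟦X⟧)⁻¹, inv_mem_semigroupRing f.2⟩ ?_
    exact Subtype.ext (PowerSeries.mul_inv_cancel _ h0)
  exact RingHom.domain_isLocalRing (semigroupRing k H).val.toRingHom

variable (k H) in
/-- The set of the Ulrich ideals of `k[[H]]` that are not parameter ideals and are generated by
monomials in `t`. -/
def monomialUlrichIdeals : Set (Ideal (semigroupRing k H)) :=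
  {I | IsUlrichIdeal I ∧ ¬ IsParameterIdeal I ∧
    ∃ S : Set H, I = Ideal.span (monomialOf k '' S)}

end SemigroupRing

/-!
A monomial ideal `I` of `k[[H]]` is determined by its set `E` of exponents, an ideal of the
semigroup `H`; let `a` be the least element of `E`. The proof translates the conditions on `I` into
conditions on `E` and uses the symmetry of `H`.

*Symmetry.* The ring `k[[H]]` is a domain of dimension one, so the Gorenstein condition provides a
nonzero `f` in the maximal ideal with `(f)` irreducible. Two distinct pseudo-Frobenius numbers
`y, z` of `H` would give `(f) = (f, f t ^ y) ∩ (f, f t ^ z)`. So there is at most one of them, which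
means that `H` is symmetric (`isSymmetricSemigroup_of_isGorensteinLocalRing`).

*Ulrich ideals have the stated form.* Parameter ideals are principal, and comparing orders in
`I ^ 2 = (f) I` gives `E + E = a + E`. As `I / I ^ 2` is free, `t ^ a` and `t ^ s`, for any minimal
generator `s ≠ a` of `E`, are part of a basis of it. So `h + s = h' + a` with `h, h' ∈ H` forces
`h ∈ E` (`mem_of_mul_eq_mul_of_free_cotangent`). Choose `t ∈ H \ E` with `t + p ∈ E` for all nonzero
`p ∈ H`. Then `s + t - a` is a pseudo-Frobenius number of `H`, that is, its Frobenius number, which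
leaves a single possibility `b` for `s`. Hence `E = (a + H) ∪ (b + H)`, and the above relations show
that `E = H ∩ (H - c)` for `c = b - a` (`exists_generator_of_semigroupIdeal`).

*Symmetry of `K = H + ⟨c⟩`.* If `2 c ∈ H`, then `K = H ∪ (c + H)`, and for a symmetric `H` with
Frobenius number `F` we have `z ∉ K` if and only if `F - z ∈ H ∩ (H - c)`. Therefore `K` is symmetric
if and only if `H ∩ (H - c) = a + K` (`isSymmetricSemigroup_sup_closure_iff`). This settles the
symmetry of `K` for an Ulrich ideal. Conversely, it describes the exponents of `(t ^ a, t ^ b)`,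
and the description implies that a relation `p t ^ a + q t ^ b ∈ I ^ 2 = t ^ a I` has `p, q ∈ I`;
so `I / I ^ 2` is free (`free_cotangent_of_span_pair`).
-/

open scoped PowerSeries

/-! ### Freeness of the conormal module -/

section Conormal

variable {A : Type*} [CommRing A]

/-- If some basis of `I / I ^ 2` gives `z` only coordinates in the maximal ideal,
then `z ∈ 𝔪 I`. -/
theorem mem_maximalIdeal_mul_of_repr_mem [IsLocalRing A] {I : Ideal A}
    (hI : I ≤ IsLocalRing.maximalIdeal A) {ι : Type*}
    (B : Module.Basis ι (A ⧸ I) I.Cotangent) (z : I)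
    (hz : ∀ j, ∀ r : A, Ideal.Quotient.mk I r = B.repr (I.toCotangent z) j →
      r ∈ IsLocalRing.maximalIdeal A) :
    (z : A) ∈ IsLocalRing.maximalIdeal A * I := by
  classical
  choose r hr using fun j => Ideal.Quotient.mk_surjective (B.repr (I.toCotangent z) j)
  choose b hb using fun j => I.toCotangent_surjective (B j)
  set s := (B.repr (I.toCotangent z)).support
  have h1 : I.toCotangent z = I.toCotangent (∑ j ∈ s, r j • b j) := by
    rw [map_sum]
    conv_lhs => rw [← B.linearCombination_repr (I.toCotangent z), Finsupp.linearCombination_apply,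
      Finsupp.sum]
    refine Finset.sum_congr rfl fun j _ => ?_
    rw [map_smul, hb, ← hr j]
    exact algebraMap_smul (A ⧸ I) (r j) (B j)
  rw [Ideal.toCotangent_eq] at h1
  have h2 : ((∑ j ∈ s, r j • b j : I) : A) ∈ IsLocalRing.maximalIdeal A * I := by
    rw [AddSubmonoidClass.coe_finsetSum]
    refine Ideal.sum_mem _ fun j _ => ?_
    exact Ideal.mul_mem_mul (hz j _ (hr j)) (b j).2
  have h3 : I ^ 2 ≤ IsLocalRing.maximalIdeal A * I := by
    rw [pow_two]
    exact Ideal.mul_mono_left hI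
  simpa using add_mem (h3 h1) h2

/-- Let `I / I ^ 2` be free over `A / I` and let `x`, `y` be part of a minimal system of
generators of `I`. Then a relation `p y = q x` has its coefficient `p` in `I`. -/
theorem mem_of_mul_eq_mul_of_free_cotangent [IsLocalRing A] {I : Ideal A}
    (hI : I ≤ IsLocalRing.maximalIdeal A) [Module.Free (A ⧸ I) I.Cotangent] {x y : A}
    (hx : x ∈ I) (hy : y ∈ I) (hx' : x ∉ IsLocalRing.maximalIdeal A * I)
    (hy' : ∀ w, y - w * x ∉ IsLocalRing.maximalIdeal A * I) {p q : A}
    (h : p * y = q * x) : p ∈ I := by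
  let B := Module.Free.chooseBasis (A ⧸ I) I.Cotangent
  obtain ⟨j, u, hu, hum⟩ : ∃ j, ∃ u : A,
      Ideal.Quotient.mk I u = B.repr (I.toCotangent ⟨x, hx⟩) j ∧
        u ∉ IsLocalRing.maximalIdeal A := by
    by_contra! hcon
    exact hx' (mem_maximalIdeal_mul_of_repr_mem hI B ⟨x, hx⟩ hcon)
  obtain ⟨u', huu'⟩ : ∃ u', u * u' = 1 :=
    (IsLocalRing.notMem_maximalIdeal.mp hum).exists_right_inv
  obtain ⟨v, hv⟩ := Ideal.Quotient.mk_surjective (B.repr (I.toCotangent ⟨y, hy⟩) j)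
  -- subtracting a multiple of `x` from `y` makes the `j`-th coordinate vanish
  let z : I := ⟨y, hy⟩ - (v * u') • ⟨x, hx⟩
  obtain ⟨l, d, hd, hdm⟩ : ∃ l, ∃ d : A,
      Ideal.Quotient.mk I d = B.repr (I.toCotangent z) l ∧
        d ∉ IsLocalRing.maximalIdeal A := by
    by_contra! hcon
    exact hy' (v * u') (mem_maximalIdeal_mul_of_repr_mem hI B z hcon)
  have hsm : ∀ (a : A) (t : I) (i), B.repr (I.toCotangent (a • t)) i =
      Ideal.Quotient.mk I a * B.repr (I.toCotangent t) i := by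
    intro a t i
    rw [map_smul, ← algebraMap_smul (A ⧸ I) a (I.toCotangent t), map_smul]
    rfl
  have hrel : ∀ i, Ideal.Quotient.mk I p * B.repr (I.toCotangent ⟨y, hy⟩) i =
      Ideal.Quotient.mk I q * B.repr (I.toCotangent ⟨x, hx⟩) i := by
    intro i
    rw [← hsm, ← hsm]
    congr 3
    exact Subtype.ext h
  have hz : B.repr (I.toCotangent z) l = B.repr (I.toCotangent ⟨y, hy⟩) l -
      Ideal.Quotient.mk I (v * u') * B.repr (I.toCotangent ⟨x, hx⟩) l := by
    rw [← hsm, map_sub, map_sub]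
    rfl
  have hj := hrel j
  rw [← hu, ← hv] at hj
  have h1 : Ideal.Quotient.mk I u * Ideal.Quotient.mk I u' = 1 := by
    rw [← map_mul, huu', map_one]
  have h0 : Ideal.Quotient.mk I p * Ideal.Quotient.mk I d = 0 := by
    rw [hd, hz, map_mul]
    linear_combination hrel l -
      Ideal.Quotient.mk I u' * B.repr (I.toCotangent ⟨x, hx⟩) l * hj -
      Ideal.Quotient.mk I q * B.repr (I.toCotangent ⟨x, hx⟩) l * h1
  rw [← map_mul, Ideal.Quotient.eq_zero_iff_mem] at h0
  exact (Ideal.mul_unit_mem_iff_mem I (IsLocalRing.notMem_maximalIdeal.mp hdm)).mp h0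

/-- If every relation modulo `I ^ 2` between the two generators of `I` has its coefficients in `I`,
then the generators form a basis of `I / I ^ 2` over `A / I`. -/
theorem free_cotangent_of_span_pair {I : Ideal A} {x y : A} (hI : I = Ideal.span {x, y})
    (h : ∀ p q, p * x + q * y ∈ I ^ 2 → p ∈ I ∧ q ∈ I) :
    Module.Free (A ⧸ I) I.Cotangent := by
  have hx : x ∈ I := hI ▸ Ideal.subset_span (by simp)
  have hy : y ∈ I := hI ▸ Ideal.subset_span (by simp)
  have hcomb : ∀ p q : A, Ideal.Quotient.mk I p • I.toCotangent ⟨x, hx⟩ +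
      Ideal.Quotient.mk I q • I.toCotangent ⟨y, hy⟩ =
        I.toCotangent ⟨p * x + q * y, I.add_mem (I.mul_mem_left p hx) (I.mul_mem_left q hy)⟩ := by
    intro p q
    have e : ∀ (a : A) (m : I.Cotangent), Ideal.Quotient.mk I a • m = a • m :=
      fun a m => algebraMap_smul (A ⧸ I) a m
    rw [e, e, ← map_smul, ← map_smul, ← map_add]
    rfl
  refine Module.Free.of_basis (Module.Basis.mk (v := ![I.toCotangent ⟨x, hx⟩,
    I.toCotangent ⟨y, hy⟩]) ?_ ?_)
  · rw [LinearIndependent.pair_iff]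
    intro s t hst
    obtain ⟨p, rfl⟩ := Ideal.Quotient.mk_surjective s
    obtain ⟨q, rfl⟩ := Ideal.Quotient.mk_surjective t
    rw [hcomb, Ideal.toCotangent_eq_zero] at hst
    simpa only [Ideal.Quotient.eq_zero_iff_mem] using h p q hst
  · intro m _
    obtain ⟨⟨z, hz⟩, rfl⟩ := I.toCotangent_surjective m
    obtain ⟨p, q, rfl⟩ := Ideal.mem_span_pair.mp (hI ▸ hz)
    rw [← hcomb]
    exact add_mem (Submodule.smul_mem _ _ (Submodule.subset_span ⟨0, rfl⟩))
      (Submodule.smul_mem _ _ (Submodule.subset_span ⟨1, rfl⟩))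

end Conormal

/-! ### Divisibility and dimension in semigroup rings -/

section Basic

variable {k : Type*} [Field k] {H : AddSubmonoid ℕ}

theorem mem_maximalIdeal_semigroupRing_iff {f : semigroupRing k H} :
    f ∈ IsLocalRing.maximalIdeal (semigroupRing k H) ↔
      PowerSeries.coeff 0 (f : k⟦X⟧) = 0 := by
  rw [IsLocalRing.mem_maximalIdeal, mem_nonunits_iff, not_iff_comm,
    PowerSeries.coeff_zero_eq_constantCoeff_apply]
  constructor
  · intro h0
    refine IsUnit.of_mul_eq_one ⟨(f : k⟦X⟧)⁻¹, inv_mem_semigroupRing f.2⟩ ?_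
    exact Subtype.ext (PowerSeries.mul_inv_cancel _ h0)
  · intro h
    exact (PowerSeries.isUnit_iff_constantCoeff.mp
      (h.map (semigroupRing k H).val)).ne_zero

/-- A series whose order is large compared to that of `f` is divisible by `f` in `k[[H]]`. -/
theorem dvd_of_X_pow_dvd {C : ℕ} (hC : ∀ n ≥ C, n ∈ H) {f g : semigroupRing k H}
    (hf : (f : k⟦X⟧) ≠ 0)
    (hg : (PowerSeries.X : k⟦X⟧) ^ ((f : k⟦X⟧).order.toNat + C) ∣ g) : f ∣ g := by
  obtain ⟨g', hg'⟩ := hg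
  set p := (f : k⟦X⟧).order.toNat with hp
  obtain ⟨u, hu⟩ : PowerSeries.X ^ p ∣ (f : k⟦X⟧) := PowerSeries.X_pow_order_dvd
  have hu0 : PowerSeries.constantCoeff u ≠ 0 := by
    have := PowerSeries.coeff_order hf
    rw [← hp, hu] at this
    simpa [PowerSeries.coeff_X_pow_mul'] using this
  refine ⟨⟨PowerSeries.X ^ C * (g' * u⁻¹), ?_⟩, Subtype.ext ?_⟩
  · intro n hn
    refine hC n ?_
    by_contra hlt
    exact hn (by rw [PowerSeries.coeff_X_pow_mul', if_neg hlt])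
  · change (g : k⟦X⟧) = (f : k⟦X⟧) * (PowerSeries.X ^ C * (g' * u⁻¹))
    rw [hg', hu, pow_add]
    linear_combination (-(PowerSeries.X ^ p * PowerSeries.X ^ C * g') : k⟦X⟧) *
      PowerSeries.mul_inv_cancel u hu0

theorem exists_pow_mem_span_singleton {C : ℕ} (hC : ∀ n ≥ C, n ∈ H) {f g : semigroupRing k H}
    (hf : f ≠ 0) (hg : g ∈ IsLocalRing.maximalIdeal (semigroupRing k H)) :
    ∃ N, g ^ N ∈ Ideal.span {f} := by
  have hf' : (f : k⟦X⟧) ≠ 0 := fun h => hf (Subtype.ext h)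
  refine ⟨(f : k⟦X⟧).order.toNat + C, Ideal.mem_span_singleton.mpr (dvd_of_X_pow_dvd hC hf' ?_)⟩
  rw [mem_maximalIdeal_semigroupRing_iff, PowerSeries.coeff_zero_eq_constantCoeff_apply,
    ← PowerSeries.X_dvd_iff] at hg
  exact pow_dvd_pow_of_dvd hg _

theorem ringKrullDim_semigroupRing {C : ℕ} (hC : ∀ n ≥ C, n ∈ H) :
    ringKrullDim (semigroupRing k H) = 1 := by
  rw [ringKrullDim_eq_one_iff_of_isLocalRing_isDomain]
  refine ⟨fun hfield => ?_, fun f hf g hg => exists_pow_mem_span_singleton hC hf hg⟩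
  have hmem : C + 1 ∈ H := hC _ (Nat.le_succ C)
  have h0 : monomialOf k ⟨C + 1, hmem⟩ ≠ 0 := fun h =>
    pow_ne_zero (C + 1) PowerSeries.X_ne_zero (congrArg Subtype.val h)
  have hm : monomialOf k ⟨C + 1, hmem⟩ ∈ IsLocalRing.maximalIdeal (semigroupRing k H) := by
    rw [mem_maximalIdeal_semigroupRing_iff]
    simp [monomialOf]
  rw [IsLocalRing.isField_iff_maximalIdeal_eq.mp hfield] at hm
  exact h0 hm

/-- As `k[[H]]` has dimension one, its parameter ideals are the principal ideals primary to the
maximal ideal. -/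
theorem isParameterIdeal_semigroupRing_iff {C : ℕ} (hC : ∀ n ≥ C, n ∈ H)
    {Q : Ideal (semigroupRing k H)} :
    IsParameterIdeal Q ↔
      (∃ f, Q = Ideal.span {f}) ∧ Q.radical = IsLocalRing.maximalIdeal (semigroupRing k H) := by
  constructor
  · rintro ⟨d, x, hd, hQ, hrad⟩
    rw [ringKrullDim_semigroupRing hC] at hd
    obtain rfl : d = 1 := by exact_mod_cast hd.symm
    exact ⟨⟨x 0, by rw [hQ, Set.range_unique]; rfl⟩, hrad⟩
  · rintro ⟨⟨f, hf⟩, hrad⟩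
    refine ⟨1, fun _ => f, by rw [ringKrullDim_semigroupRing hC]; rfl, ?_, hrad⟩
    rw [hf, Set.range_const]

end Basic

/-! ### Monomial ideals -/

section Monomial

variable {k : Type*} [Field k] {H : AddSubmonoid ℕ}

theorem coe_monomialOf (h : H) :
    (monomialOf k h : k⟦X⟧) = PowerSeries.X ^ (h : ℕ) := rfl

theorem monomialOf_add (h h' : H) :
    monomialOf k (h + h') = monomialOf k h * monomialOf k h' :=
  Subtype.ext (pow_add _ _ _)

theorem monomialOf_ne_zero (h : H) : monomialOf k h ≠ 0 := fun e =>
  pow_ne_zero (h : ℕ) PowerSeries.X_ne_zero (congrArg Subtype.val e)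

/-- A monomial ideal consists of the series all of whose exponents belong to the corresponding
ideal of the semigroup. -/
theorem mem_span_monomialOf_iff {C : ℕ} (hC : ∀ n ≥ C, n ∈ H) {S : Set H}
    {f : semigroupRing k H} :
    f ∈ Ideal.span (monomialOf k '' S) ↔
      ∀ n, PowerSeries.coeff n (f : k⟦X⟧) ≠ 0 → ∃ s ∈ S, ∃ h : H, (s + h : ℕ) = n := by
  constructor
  · intro hf
    induction hf using Submodule.span_induction with
    | mem x hx =>
      obtain ⟨s, hs, rfl⟩ := hx
      intro n hn
      refine ⟨s, hs, 0, ?_⟩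
      rw [coe_monomialOf, PowerSeries.coeff_X_pow] at hn
      by_contra hne
      exact hn (if_neg fun e => hne (by simpa using e.symm))
    | zero => exact fun n hn => absurd (map_zero _) hn
    | add x y _ _ ihx ihy =>
      intro n hn
      by_cases hx : PowerSeries.coeff n (x : k⟦X⟧) = 0
      · refine ihy n fun hy => hn ?_
        change PowerSeries.coeff n ((x : k⟦X⟧) + (y : k⟦X⟧)) = 0
        rw [map_add, hx, hy, add_zero]
      · exact ihx n hx
    | smul r x _ ih =>
      intro n hn
      change PowerSeries.coeff n ((r : k⟦X⟧) * (x : k⟦X⟧)) ≠ 0 at hn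
      rw [PowerSeries.coeff_mul] at hn
      obtain ⟨p, hp, hne⟩ := Finset.exists_ne_zero_of_sum_ne_zero hn
      obtain ⟨s, hs, h, hsh⟩ := ih _ (right_ne_zero_of_mul hne)
      refine ⟨s, hs, h + ⟨p.1, r.2 _ (left_ne_zero_of_mul hne)⟩, ?_⟩
      have := Finset.HasAntidiagonal.mem_antidiagonal.mp hp
      push_cast
      omega
  · intro hf
    by_cases hf0 : (f : k⟦X⟧) = 0
    · rw [show f = 0 from Subtype.ext hf0]
      exact zero_mem _
    obtain ⟨m, hm⟩ := PowerSeries.exists_coeff_ne_zero_iff_ne_zero.mpr hf0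
    obtain ⟨a, ha, -⟩ := hf m hm
    -- the terms of degree at least `a + C` form a multiple of `t ^ a`; finitely many remain
    let term : ℕ → semigroupRing k H := fun n =>
      ⟨PowerSeries.monomial n (PowerSeries.coeff n (f : k⟦X⟧)), fun j hj => by
        rw [PowerSeries.coeff_monomial] at hj
        split_ifs at hj with e
        · exact f.2 j (e ▸ hj)
        · exact absurd rfl hj⟩
    have hterm : ∀ n, term n ∈ Ideal.span (monomialOf k '' S) := by
      intro n
      by_cases hn : PowerSeries.coeff n (f : k⟦X⟧) = 0
      · rw [show term n = 0 from Subtype.ext (by simp [term, hn])]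
        exact zero_mem _
      · obtain ⟨s, hs, h, hsh⟩ := hf n hn
        have e : term n = algebraMap k (semigroupRing k H) (PowerSeries.coeff n (f : k⟦X⟧)) *
            monomialOf k h * monomialOf k s := by
          refine Subtype.ext ?_
          change PowerSeries.monomial n _ = algebraMap k k⟦X⟧ _ * PowerSeries.X ^ (h : ℕ) *
            PowerSeries.X ^ (s : ℕ)
          rw [mul_assoc, ← pow_add, add_comm, hsh, PowerSeries.algebraMap_apply,
            PowerSeries.monomial_eq_mk]
          ext j
          simp [PowerSeries.coeff_X_pow]
        rw [e]
        exact Ideal.mul_mem_left _ _ (Ideal.subset_span ⟨s, hs, rfl⟩)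
    have hrest : f - ∑ n ∈ Finset.range (a + C), term n ∈ Ideal.span (monomialOf k '' S) := by
      refine Ideal.mem_of_dvd _ (dvd_of_X_pow_dvd hC (f := monomialOf k a) ?_ ?_)
        (Ideal.subset_span ⟨a, ha, rfl⟩)
      · exact pow_ne_zero _ PowerSeries.X_ne_zero
      · rw [coe_monomialOf, PowerSeries.order_X_pow, ENat.toNat_natCast, PowerSeries.X_pow_dvd_iff]
        intro m hm
        change PowerSeries.coeff m
          ((f : k⟦X⟧) - ((∑ n ∈ Finset.range (a + C), term n : semigroupRing k H) : k⟦X⟧)) = 0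
        rw [AddSubmonoidClass.coe_finsetSum, map_sub, map_sum, sub_eq_zero]
        simp only [term, PowerSeries.coeff_monomial]
        rw [Finset.sum_ite_eq, if_pos (Finset.mem_range.mpr hm)]
    have := add_mem hrest (Ideal.sum_mem _ fun n (_ : n ∈ Finset.range (a + C)) => hterm n)
    simpa using this

theorem monomialOf_mem_span_monomialOf_iff {C : ℕ} (hC : ∀ n ≥ C, n ∈ H) {S : Set H} {e : H} :
    monomialOf k e ∈ Ideal.span (monomialOf k '' S) ↔
      ∃ s ∈ S, ∃ h : H, (s + h : ℕ) = e := by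
  rw [mem_span_monomialOf_iff hC]
  constructor
  · intro h
    exact h e (by simp [coe_monomialOf])
  · intro h n hn
    rw [coe_monomialOf, PowerSeries.coeff_X_pow] at hn
    split_ifs at hn with hne
    · exact hne ▸ h
    · exact absurd rfl hn

end Monomial

/-! ### Gorenstein semigroup rings come from symmetric semigroups -/

section Gorenstein

variable {k : Type*} [Field k] {H : AddSubmonoid ℕ}

/-- In a one-dimensional `k[[H]]`, the Gorenstein condition yields a nonzero element of the maximal
ideal that generates an irreducible ideal. -/
theorem exists_infIrred_span_singleton {C : ℕ} (hC : ∀ n ≥ C, n ∈ H)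
    (hGor : IsGorensteinLocalRing (semigroupRing k H)) :
    ∃ f ∈ IsLocalRing.maximalIdeal (semigroupRing k H), f ≠ 0 ∧ InfIrred (Ideal.span {f}) := by
  obtain ⟨-, x, hreg, hrad, hirr⟩ := hGor
  have hle : ∀ y ∈ x, y ∈ IsLocalRing.maximalIdeal (semigroupRing k H) := fun y hy =>
    hrad ▸ Ideal.le_radical (Ideal.subset_span hy)
  have htop : Ideal.ofList x ≠ ⊤ := fun h => by
    rw [h, Ideal.radical_top] at hrad
    exact (IsLocalRing.maximalIdeal.isMaximal _).ne_top hrad.symm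
  match x, hreg, hrad, hirr, hle, htop with
  | [], _, hrad, _, _, _ =>
    have hmem : C + 1 ∈ H := hC _ (Nat.le_succ C)
    have hm : monomialOf k ⟨C + 1, hmem⟩ ∈ IsLocalRing.maximalIdeal (semigroupRing k H) := by
      rw [mem_maximalIdeal_semigroupRing_iff]
      simp [monomialOf]
    rw [← hrad, Ideal.ofList_nil] at hm
    obtain ⟨n, hn⟩ := hm
    exact absurd hn (pow_ne_zero n (monomialOf_ne_zero _))
  | f :: rest, hreg, _, hirr, hle, htop =>
    have hw := (RingTheory.Sequence.isWeaklyRegular_iff _ _).mp hreg.toIsWeaklyRegular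
    have hf0 : f ≠ 0 := by
      intro h0
      have h := hw 0 (by simp)
      rw [List.getElem_cons_zero, List.take_zero, h0] at h
      refine htop ((Ideal.eq_top_iff_one _).mpr ?_)
      have h1 := h (a₁ := Submodule.Quotient.mk 1) (a₂ := 0) (by simp)
      rw [Submodule.Quotient.mk_eq_zero] at h1
      simp at h1
    refine ⟨f, hle f (by simp), hf0, ?_⟩
    match rest, hw, hirr, hle, htop with
    | [], _, hirr, _, _ => rwa [Ideal.ofList_singleton] at hirr
    | g :: rest, hw, _, hle, htop =>
      -- `g` is nilpotent modulo `f`, hence it cannot be regular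
      exfalso
      have h := hw 1 (by simp)
      rw [List.getElem_cons_succ, List.getElem_cons_zero, List.take_succ_cons, List.take_zero,
        Ideal.ofList_singleton] at h
      obtain ⟨N, hN⟩ := exists_pow_mem_span_singleton hC hf0 (hle g (by simp))
      have h1 := (h.pow N) (a₁ := Submodule.Quotient.mk 1) (a₂ := 0) (by
        refine Eq.trans ?_ (smul_zero _).symm
        change (Submodule.Quotient.mk (g ^ N • 1) : _ ⧸ _) = 0
        rw [Submodule.Quotient.mk_eq_zero]
        simpa using hN)
      rw [Submodule.Quotient.mk_eq_zero] at h1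
      refine htop ((Ideal.eq_top_iff_one _).mpr ?_)
      rw [Ideal.ofList_cons]
      refine Ideal.mem_sup_left ?_
      simpa using h1

/-- Multiplication by `t ^ z` maps `f ∈ 𝔪` into `k[[H]]` when `z` is a pseudo-Frobenius number. -/
theorem exists_eq_mul_X_pow {z : ℕ} (hz : ∀ p ∈ H, p ≠ 0 → z + p ∈ H) {f : semigroupRing k H}
    (hf : f ∈ IsLocalRing.maximalIdeal (semigroupRing k H)) :
    ∃ g : semigroupRing k H, (g : k⟦X⟧) = f.1 * PowerSeries.X ^ z := by
  refine ⟨⟨f.1 * PowerSeries.X ^ z, fun n hn => ?_⟩, rfl⟩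
  rw [PowerSeries.coeff_mul_X_pow'] at hn
  split_ifs at hn with hle
  · have hne : n - z ≠ 0 := fun h0 => by
      rw [h0] at hn
      exact hn (mem_maximalIdeal_semigroupRing_iff.mp hf)
    have := hz _ (f.2 _ hn) hne
    rwa [Nat.add_sub_cancel' hle] at this
  · exact absurd rfl hn

/-- Two distinct pseudo-Frobenius numbers `y`, `z` would give two socle elements `f t ^ y`,
`f t ^ z` modulo `f`, and with them a decomposition of the ideal `(f)`. -/
theorem eq_of_pseudoFrobenius {f : semigroupRing k H}
    (hf : f ∈ IsLocalRing.maximalIdeal (semigroupRing k H)) (hf0 : f ≠ 0)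
    (hirr : InfIrred (Ideal.span {f})) {y z : ℕ} (hy : y ∉ H) (hz : z ∉ H)
    (hy' : ∀ p ∈ H, p ≠ 0 → y + p ∈ H) (hz' : ∀ p ∈ H, p ≠ 0 → z + p ∈ H) : y = z := by
  by_contra hne
  have hf0' : (f : k⟦X⟧) ≠ 0 := fun h => hf0 (Subtype.ext h)
  have notMem : ∀ {w : ℕ}, w ∉ H → ∀ {g : semigroupRing k H},
      (g : k⟦X⟧) = f.1 * PowerSeries.X ^ w → g ∉ Ideal.span {f} := by
    intro w hw g hg hmem
    obtain ⟨r, rfl⟩ := Ideal.mem_span_singleton.mp hmem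
    have hr : (r : k⟦X⟧) = PowerSeries.X ^ w := mul_left_cancel₀ hf0' hg
    exact hw (r.2 w (by rw [hr, PowerSeries.coeff_X_pow_self]; exact one_ne_zero))
  obtain ⟨u, hu⟩ := exists_eq_mul_X_pow hy' hf
  obtain ⟨v, hv⟩ := exists_eq_mul_X_pow hz' hf
  have hinf : Ideal.span {u, f} ⊓ Ideal.span {v, f} = Ideal.span {f} := by
    apply le_antisymm
    · rintro w ⟨hw1, hw2⟩
      obtain ⟨α, p, h1⟩ := Ideal.mem_span_pair.mp hw1
      obtain ⟨β, q, h2⟩ := Ideal.mem_span_pair.mp hw2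
      have key : (α : k⟦X⟧) * PowerSeries.X ^ y - β.1 * PowerSeries.X ^ z = q.1 - p.1 := by
        have h3 : (α : k⟦X⟧) * u.1 + p.1 * f.1 = β.1 * v.1 + q.1 * f.1 :=
          congrArg Subtype.val (h1.trans h2.symm)
        rw [hu, hv] at h3
        refine mul_left_cancel₀ hf0' ?_
        linear_combination h3
      -- the exponents `y` and `z` cannot cancel each other
      have hα : PowerSeries.coeff 0 (α : k⟦X⟧) = 0 := by
        by_contra hα0
        have hcy := congrArg (PowerSeries.coeff y) key
        have hq : PowerSeries.coeff y (q.1 - p.1) = 0 := by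
          by_contra h
          exact hy ((q - p).2 y h)
        rw [hq, map_sub, PowerSeries.coeff_mul_X_pow', if_pos le_rfl, Nat.sub_self,
          PowerSeries.coeff_mul_X_pow'] at hcy
        split_ifs at hcy with hle
        · have hβ : PowerSeries.coeff (y - z) (β : k⟦X⟧) ≠ 0 := fun h0 => hα0 (by
            rwa [h0, sub_zero] at hcy)
          have := hz' _ (β.2 _ hβ) (by omega)
          rw [Nat.add_sub_cancel' hle] at this
          exact hy this
        · exact hα0 (by rwa [sub_zero] at hcy)
      obtain ⟨r, hr⟩ := exists_eq_mul_X_pow hy'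
        (mem_maximalIdeal_semigroupRing_iff.mpr hα)
      refine Ideal.mem_span_singleton.mpr ⟨r + p, ?_⟩
      rw [← h1]
      refine Subtype.ext ?_
      change (α : k⟦X⟧) * u.1 + p.1 * f.1 = f.1 * (r.1 + p.1)
      rw [hu, hr]
      ring
    · exact le_inf (Ideal.span_mono (by simp)) (Ideal.span_mono (by simp))
  rcases hirr.2 hinf with h | h
  · exact notMem hy hu (h ▸ Ideal.subset_span (by simp))
  · exact notMem hz hv (h ▸ Ideal.subset_span (by simp))

/-- Membership of an integer in a numerical semigroup. -/
def IsExponent (H : AddSubmonoid ℕ) (z : ℤ) : Prop := ∃ n ∈ H, (n : ℤ) = z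

theorem isExponent_natCast {n : ℕ} : IsExponent H n ↔ n ∈ H := by
  simp [IsExponent]

theorem IsExponent.add {y z : ℤ} (hy : IsExponent H y) (hz : IsExponent H z) :
    IsExponent H (y + z) := by
  obtain ⟨m, hm, rfl⟩ := hy
  obtain ⟨n, hn, rfl⟩ := hz
  exact ⟨m + n, H.add_mem hm hn, by push_cast; rfl⟩

theorem IsExponent.nonneg {z : ℤ} (hz : IsExponent H z) : 0 ≤ z := by
  obtain ⟨n, -, rfl⟩ := hz
  exact Int.natCast_nonneg n

/-- A numerical semigroup with at most one pseudo-Frobenius number is symmetric. -/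
theorem isSymmetricSemigroup_of_pseudoFrobenius {C : ℕ} (hC : ∀ n ≥ C, n ∈ H)
    (huniq : ∀ y z : ℕ, y ∉ H → z ∉ H → (∀ p ∈ H, p ≠ 0 → y + p ∈ H) →
      (∀ p ∈ H, p ≠ 0 → z + p ∈ H) → y = z) : IsSymmetricSemigroup H := by
  have hbd : ∀ P : ℤ → Prop, (∃ z, P z) → (∀ z, P z → ¬ IsExponent H z) →
      ∃ z, IsGreatest {z | P z} z := by
    intro P hP hlt
    obtain ⟨m, hm, hmax⟩ := Int.exists_greatest_of_bdd (P := P) ⟨C, fun z hz => by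
      by_contra! hCz
      refine hlt z hz ⟨z.toNat, hC _ (by omega), by omega⟩⟩ hP
    exact ⟨m, hm, hmax⟩
  obtain ⟨F, hF, hFmax⟩ := hbd (fun z => ¬ IsExponent H z)
    ⟨-1, fun h => by have := h.nonneg; omega⟩ fun _ h => h
  refine ⟨F, ⟨hF, hFmax⟩, fun z => ⟨fun hz hz' => hF ?_, fun hz => ?_⟩⟩
  · have := IsExponent.add hz hz'
    rwa [add_sub_cancel] at this
  · by_contra hz'
    obtain ⟨m, ⟨hm, hFm⟩, hmax⟩ := hbd (fun z => ¬ IsExponent H z ∧ ¬ IsExponent H (F - z))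
      ⟨z, hz', hz⟩ fun _ h => h.1
    have hmF : m < F := by
      refine lt_of_le_of_ne (hFmax hm) ?_
      rintro rfl
      exact hFm ⟨0, H.zero_mem, by simp⟩
    have hm0 : 0 ≤ m := by
      by_contra! hneg
      have := hFmax hFm
      omega
    -- by maximality `m` is a pseudo-Frobenius number
    lift m to ℕ using hm0
    lift F to ℕ using by omega
    rw [isExponent_natCast] at hm
    refine absurd (huniq m F hm (fun h => hF (isExponent_natCast.mpr h)) ?_ ?_) (by omega)
    · intro p hp hp0
      by_contra hmp
      have hnot : IsExponent H (F - (m + p : ℕ)) := by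
        by_contra hn
        have := hmax ⟨fun h => hmp (isExponent_natCast.mp h), hn⟩
        push_cast at this
        omega
      refine hFm ?_
      have := hnot.add (isExponent_natCast.mpr hp)
      push_cast at this
      rwa [show (F : ℤ) - (m + p) + p = F - m by ring] at this
    · intro p hp hp0
      by_contra hFp
      have := hFmax (a := ((F + p : ℕ) : ℤ)) fun h => hFp (isExponent_natCast.mp h)
      push_cast at this
      omega

/-- The ring `k[[H]]` being Gorenstein, the numerical semigroup `H` is symmetric. -/
theorem isSymmetricSemigroup_of_isGorensteinLocalRing {C : ℕ} (hC : ∀ n ≥ C, n ∈ H)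
    (hGor : IsGorensteinLocalRing (semigroupRing k H)) : IsSymmetricSemigroup H := by
  obtain ⟨f, hf, hf0, hirr⟩ := exists_infIrred_span_singleton hC hGor
  exact isSymmetricSemigroup_of_pseudoFrobenius hC fun y z hy hz hy' hz' =>
    eq_of_pseudoFrobenius hf hf0 hirr hy hz hy' hz'

end Gorenstein

/-! ### Combinatorics of symmetric semigroups -/

section Combinatorics

variable {H : AddSubmonoid ℕ}

theorem isExponent_sup_closure_iff {c : ℕ} (hc : 2 * c ∈ H) {z : ℤ} :
    IsExponent (H ⊔ AddSubmonoid.closure {c}) z ↔ IsExponent H z ∨ IsExponent H (z - c) := by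
  have hmul : ∀ i : ℕ, 2 * i * c ∈ H := fun i => by
    rw [mul_comm 2 i, mul_assoc, ← smul_eq_mul]
    exact H.nsmul_mem hc i
  constructor
  · rintro ⟨n, hn, rfl⟩
    obtain ⟨h, hh, m, hm, rfl⟩ := AddSubmonoid.mem_sup.mp hn
    obtain ⟨i, rfl⟩ := AddSubmonoid.mem_closure_singleton.mp hm
    rcases Nat.even_or_odd' i with ⟨j, rfl | rfl⟩
    · exact Or.inl ⟨_, H.add_mem hh (hmul j), by rw [smul_eq_mul]⟩
    · exact Or.inr ⟨_, H.add_mem hh (hmul j), by push_cast [smul_eq_mul]; ring⟩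
  · rintro (⟨n, hn, rfl⟩ | ⟨n, hn, hz⟩)
    · exact ⟨n, AddSubmonoid.mem_sup_left hn, rfl⟩
    · exact ⟨n + c, AddSubmonoid.add_mem_sup hn (AddSubmonoid.subset_closure rfl),
        by push_cast; omega⟩

/-- For a symmetric semigroup `H`, reflecting the complement of `H + ⟨c⟩ = H ∪ (c + H)` gives
`H ∩ (H - c)`. Hence `H + ⟨c⟩` is symmetric if and only if `H ∩ (H - c)` is a translate of it. -/
theorem isSymmetricSemigroup_sup_closure_iff {a c : ℕ} (hH : IsSymmetricSemigroup H)
    (hc : 2 * c ∈ H) (ha : IsLeast {h : ℕ | h ∈ H ∧ h + c ∈ H} a) :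
    IsSymmetricSemigroup (H ⊔ AddSubmonoid.closure {c}) ↔
      ∀ z : ℤ, (IsExponent H z ∧ IsExponent H (z + c)) ↔
        IsExponent (H ⊔ AddSubmonoid.closure {c}) (z - a) := by
  obtain ⟨F, -, hF⟩ := hH
  change ∀ z, IsExponent H z ↔ ¬ IsExponent H (F - z) at hF
  set K := H ⊔ AddSubmonoid.closure {c} with hK
  have hK0 : IsExponent K 0 := ⟨0, K.zero_mem, rfl⟩
  have hrefl : ∀ z, ¬ IsExponent K z ↔ IsExponent H (F - z) ∧ IsExponent H (F - z + c) := by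
    intro z
    rw [isExponent_sup_closure_iff hc, hF z, hF (z - c),
      show F - (z - c) = F - z + c by ring]
    tauto
  constructor
  · rintro ⟨G, -, hG⟩
    change ∀ z, IsExponent K z ↔ ¬ IsExponent K (G - z) at hG
    have hG' : ∀ z, (IsExponent H z ∧ IsExponent H (z + c)) ↔ IsExponent K (G - F + z) := by
      intro z
      have h1 := hrefl (F - z)
      rw [sub_sub_cancel] at h1
      rw [← h1, hG (F - z), not_not, show G - (F - z) = G - F + z by ring]
    have h1 : 0 ≤ G - F + a := ((hG' a).mp ⟨⟨a, ha.1.1, rfl⟩, ⟨a + c, ha.1.2, by simp⟩⟩).nonneg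
    obtain ⟨⟨m, hm, hmz⟩, n, hn, hnz⟩ := (hG' (F - G)).mpr (by simpa using hK0)
    have h2 : a ≤ m := ha.2 ⟨hm, by rwa [show m + c = n by omega]⟩
    intro z
    rw [hG', show G - F + z = z - a by omega]
  · intro h
    have hsymm : ∀ z, IsExponent K z ↔ ¬ IsExponent K (F - a - z) := by
      intro z
      rw [show F - a - z = F - z - a by ring, ← h, ← hrefl, not_not]
    refine ⟨F - a, ⟨fun hmem => ?_, fun z hz => ?_⟩, hsymm⟩
    · exact (hsymm _).mp hmem (by simpa using hK0)
    · by_contra! hlt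
      refine hz ((hsymm z).mpr fun hn => ?_)
      have := hn.nonneg
      omega

/-- A proper ideal `E` of a numerical semigroup has a socle: there is `t ∈ H \ E` all of whose
proper translates by elements of `H` lie in `E`. -/
theorem exists_socle {C : ℕ} (hC : ∀ n ≥ C, n ∈ H) {E : Set ℕ} (hE0 : 0 ∉ E) (hne : E.Nonempty)
    (hEadd : ∀ e ∈ E, ∀ h ∈ H, e + h ∈ E) :
    ∃ t ∈ H, t ∉ E ∧ ∀ p ∈ H, p ≠ 0 → t + p ∈ E := by
  classical
  obtain ⟨a, ha⟩ := hne
  have hspec : Nat.findGreatest (fun n => n ∈ H ∧ n ∉ E) (a + C) ∈ H ∧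
      Nat.findGreatest (fun n => n ∈ H ∧ n ∉ E) (a + C) ∉ E :=
    Nat.findGreatest_spec (P := fun n => n ∈ H ∧ n ∉ E) (Nat.zero_le (a + C))
      ⟨H.zero_mem, hE0⟩
  refine ⟨_, hspec.1, hspec.2, fun p hp hp0 => ?_⟩
  by_contra hcon
  rcases le_or_gt (Nat.findGreatest (fun n => n ∈ H ∧ n ∉ E) (a + C) + p) (a + C) with hle | hgt
  · have := Nat.le_findGreatest (P := fun n => n ∈ H ∧ n ∉ E) hle
      ⟨H.add_mem hspec.1 hp, hcon⟩
    omega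
  · refine hcon ?_
    have := hEadd a ha _ (hC (Nat.findGreatest (fun n => n ∈ H ∧ n ∉ E) (a + C) + p - a) (by omega))
    rwa [Nat.add_sub_cancel' (by omega)] at this

/-- Let `E` be a non-principal ideal of a symmetric numerical semigroup `H` with least element `a`,
such that `E + E = a + E`, and such that `E` contains every `h` for which some further minimal
generator `s` satisfies `h + s ∈ a + H`. Then `E` is generated by `a` and one more element
`b = a + c`, and `E = H ∩ (H - c) = a + (H + ⟨c⟩)`. -/
theorem exists_generator_of_semigroupIdeal {C : ℕ} (hC : ∀ n ≥ C, n ∈ H)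
    (hH : IsSymmetricSemigroup H) {E : Set ℕ} {a : ℕ} (hE0 : 0 ∉ E) (hEH : ∀ e ∈ E, e ∈ H)
    (hEadd : ∀ e ∈ E, ∀ h ∈ H, e + h ∈ E) (ha : IsLeast E a)
    (hsq : ∀ e ∈ E, ∀ e' ∈ E, ∃ e'' ∈ E, e + e' = a + e'')
    (hrel : ∀ s ∈ E, (∀ h ∈ H, a + h ≠ s) → (∀ e ∈ E, ∀ p ∈ H, p ≠ 0 → e + p ≠ s) →
      ∀ h ∈ H, ∀ h' ∈ H, h + s = h' + a → h ∈ E)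
    (hnp : ∃ e ∈ E, ∀ h ∈ H, a + h ≠ e) :
    ∃ b ∈ E, a < b ∧ (∀ e ∈ E, (∃ h ∈ H, a + h = e) ∨ ∃ h ∈ H, b + h = e) ∧
      b - a ∉ H ∧ 2 * (b - a) ∈ H ∧
      IsSymmetricSemigroup (H ⊔ AddSubmonoid.closure {b - a}) ∧
      IsLeast {h : ℕ | h ∈ H ∧ h + (b - a) ∈ H} a := by
  classical
  obtain ⟨F, -, hF⟩ := id hH
  change ∀ z, IsExponent H z ↔ ¬ IsExponent H (F - z) at hF
  obtain ⟨t, htH, htE, ht⟩ := exists_socle hC hE0 ⟨a, ha.1⟩ hEadd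
  -- `s + t - a` is a pseudo-Frobenius number of the symmetric semigroup `H`, hence equal to `F`
  have hgen : ∀ s ∈ E, (∀ h ∈ H, a + h ≠ s) → (∀ e ∈ E, ∀ p ∈ H, p ≠ 0 → e + p ≠ s) →
      (s + t : ℤ) = a + F := by
    intro s hs hsa hsmin
    have has := ha.2 hs
    obtain ⟨w, hw⟩ : ∃ w, s + t = a + w := ⟨s + t - a, by omega⟩
    have hwH : w ∉ H := fun h => htE (hrel s hs hsa hsmin t htH w h (by omega))
    have hwF : IsExponent H (F - w) := by
      by_contra hcon
      exact hwH (isExponent_natCast.mp ((hF w).mpr hcon))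
    obtain ⟨p, hp, hpF⟩ := hwF
    rcases eq_or_ne p 0 with rfl | hp0
    · push_cast at hpF
      omega
    · exfalso
      obtain ⟨e, he, hee⟩ := hsq s hs _ (ht p hp hp0)
      have hFH : IsExponent H F := ⟨w + p, by
        rw [show w + p = e by omega]
        exact hEH e he, by push_cast; omega⟩
      exact (hF F).mp hFH ⟨0, H.zero_mem, by simp⟩
  -- the least element outside of `a + H` is a minimal generator
  have hex : ∃ b, b ∈ E ∧ ∀ h ∈ H, a + h ≠ b := hnp
  obtain ⟨b, ⟨hbE, hba⟩, hbmin⟩ : ∃ b, (b ∈ E ∧ ∀ h ∈ H, a + h ≠ b) ∧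
      ∀ m < b, ¬ (m ∈ E ∧ ∀ h ∈ H, a + h ≠ m) :=
    ⟨Nat.find hex, Nat.find_spec hex, fun m hm => Nat.find_min hex hm⟩
  have hbgen : ∀ e ∈ E, ∀ p ∈ H, p ≠ 0 → e + p ≠ b := by
    rintro e he p hp hp0 rfl
    refine hbmin e (by omega) ⟨he, ?_⟩
    rintro h hh rfl
    exact hba (h + p) (H.add_mem hh hp) (by omega)
  have hbF := hgen b hbE hba hbgen
  have hcover : ∀ e ∈ E, (∃ h ∈ H, a + h = e) ∨ ∃ h ∈ H, b + h = e := by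
    intro e
    induction e using Nat.strong_induction_on with
    | _ e ih =>
      intro he
      by_contra! hcon
      have heF := hgen e he hcon.1 (by
        rintro e' he' p hp hp0 rfl
        rcases ih e' (by omega) he' with ⟨h, hh, rfl⟩ | ⟨h, hh, rfl⟩
        · exact hcon.1 (h + p) (H.add_mem hh hp) (by omega)
        · exact hcon.2 (h + p) (H.add_mem hh hp) (by omega))
      exact hcon.2 0 H.zero_mem (by omega)
  have hab : a < b := lt_of_le_of_ne (ha.2 hbE) fun h => hba 0 H.zero_mem (by omega)
  obtain ⟨c, rfl⟩ := Nat.exists_eq_add_of_le hab.le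
  have hcH : c ∉ H := fun h => hba c h rfl
  have hc2 : 2 * c ∈ H := by
    obtain ⟨e, he, hee⟩ := hsq _ hbE _ hbE
    rcases hcover e he with ⟨h, hh, rfl⟩ | ⟨h, hh, rfl⟩
    · rwa [show 2 * c = h by omega]
    · exact absurd (by rwa [show c = h by omega]) hcH
  have hD : ∀ z : ℤ, (IsExponent H z ∧ IsExponent H (z + c)) ↔
      IsExponent (H ⊔ AddSubmonoid.closure {c}) (z - a) := by
    intro z
    rw [isExponent_sup_closure_iff hc2]
    constructor
    · rintro ⟨⟨n, hn, rfl⟩, n', hn', hnn'⟩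
      have hnE := hrel _ hbE hba hbgen n hn n' hn' (by omega)
      rcases hcover n hnE with ⟨h, hh, rfl⟩ | ⟨h, hh, rfl⟩
      · exact Or.inl ⟨h, hh, by push_cast; ring⟩
      · exact Or.inr ⟨h, hh, by push_cast; ring⟩
    · have haH := hEH a ha.1
      have hbH := hEH _ hbE
      rintro (⟨h, hh, hz⟩ | ⟨h, hh, hz⟩)
      · exact ⟨⟨a + h, H.add_mem haH hh, by push_cast; omega⟩,
          ⟨a + c + h, H.add_mem hbH hh, by push_cast; omega⟩⟩
      · exact ⟨⟨a + c + h, H.add_mem hbH hh, by push_cast; omega⟩,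
          ⟨a + (2 * c + h), H.add_mem haH (H.add_mem hc2 hh), by push_cast; omega⟩⟩
  have hleast : IsLeast {h : ℕ | h ∈ H ∧ h + c ∈ H} a := by
    refine ⟨⟨hEH a ha.1, hEH _ hbE⟩, fun n hn => ?_⟩
    have := ((hD n).mp ⟨⟨n, hn.1, rfl⟩, ⟨n + c, hn.2, by push_cast; rfl⟩⟩).nonneg
    omega
  refine ⟨a + c, hbE, hab, hcover, ?_⟩
  rw [Nat.add_sub_cancel_left]
  exact ⟨hcH, hc2, (isSymmetricSemigroup_sup_closure_iff hH hc2 hleast).mpr hD, hleast⟩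

end Combinatorics

/-! ### Monomial Ulrich ideals -/

section Ulrich

variable {k : Type*} [Field k] {H : AddSubmonoid ℕ}

/-- The exponents of the monomials contained in an ideal of `k[[H]]`. -/
def exponentSet (I : Ideal (semigroupRing k H)) : Set ℕ :=
  {n | ∃ h : H, (h : ℕ) = n ∧ monomialOf k h ∈ I}

theorem coe_mem_exponentSet_iff {I : Ideal (semigroupRing k H)} {h : H} :
    (h : ℕ) ∈ exponentSet I ↔ monomialOf k h ∈ I :=
  ⟨fun ⟨_, e, hm⟩ => Subtype.ext e ▸ hm, fun hm => ⟨h, rfl, hm⟩⟩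

theorem add_mem_exponentSet {I : Ideal (semigroupRing k H)} {e h : ℕ} (he : e ∈ exponentSet I)
    (hh : h ∈ H) : e + h ∈ exponentSet I := by
  obtain ⟨e, rfl, hm⟩ := he
  refine ⟨e + ⟨h, hh⟩, rfl, ?_⟩
  rw [monomialOf_add]
  exact Ideal.mul_mem_right _ _ hm

theorem mem_span_monomialOf_iff_exponentSet {C : ℕ} (hC : ∀ n ≥ C, n ∈ H) {S : Set H}
    {f : semigroupRing k H} :
    f ∈ Ideal.span (monomialOf k '' S) ↔ ∀ n, PowerSeries.coeff n (f : k⟦X⟧) ≠ 0 →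
      n ∈ exponentSet (Ideal.span (monomialOf k '' S)) := by
  rw [mem_span_monomialOf_iff hC]
  refine forall_congr' fun n => imp_congr_right fun _ => ?_
  constructor
  · rintro ⟨s, hs, h, rfl⟩
    exact add_mem_exponentSet (coe_mem_exponentSet_iff.mpr (Ideal.subset_span ⟨s, hs, rfl⟩)) h.2
  · rintro ⟨h, rfl, hm⟩
    exact (monomialOf_mem_span_monomialOf_iff hC).mp hm

theorem radical_eq_maximalIdeal {C : ℕ} (hC : ∀ n ≥ C, n ∈ H) {I : Ideal (semigroupRing k H)}
    (hI : I ≤ IsLocalRing.maximalIdeal (semigroupRing k H)) {f : semigroupRing k H} (hf : f ∈ I)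
    (hf0 : f ≠ 0) : I.radical = IsLocalRing.maximalIdeal (semigroupRing k H) := by
  refine le_antisymm ?_ fun g hg => ?_
  · exact (IsLocalRing.maximalIdeal.isMaximal _).isPrime.radical_le_iff.mpr hI
  · obtain ⟨N, hN⟩ := exists_pow_mem_span_singleton hC hf0 hg
    exact ⟨N, (Ideal.span_singleton_le_iff_mem I).mpr hf hN⟩

theorem exists_coeff_ne_zero_of_mul_eq_X_pow {f g : k⟦X⟧} {n : ℕ}
    (h : f * g = PowerSeries.X ^ n) :
    PowerSeries.coeff f.order.toNat f ≠ 0 ∧ PowerSeries.coeff g.order.toNat g ≠ 0 ∧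
      f.order.toNat + g.order.toNat = n := by
  have h0 : f * g ≠ 0 := h ▸ pow_ne_zero n PowerSeries.X_ne_zero
  have hf := left_ne_zero_of_mul h0
  have hg := right_ne_zero_of_mul h0
  refine ⟨PowerSeries.coeff_order hf, PowerSeries.coeff_order hg, ?_⟩
  have := congrArg PowerSeries.order h
  rw [PowerSeries.order_mul, PowerSeries.order_X_pow, ← PowerSeries.coe_toNat_order hf,
    ← PowerSeries.coe_toNat_order hg] at this
  exact_mod_cast this

/-- The exponents of the elements of `𝔪 I` for a monomial ideal `I`. -/
theorem exists_add_eq_of_mem_maximalIdeal_mul {C : ℕ} (hC : ∀ n ≥ C, n ∈ H) {S : Set H}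
    {f : semigroupRing k H}
    (hf : f ∈ IsLocalRing.maximalIdeal (semigroupRing k H) * Ideal.span (monomialOf k '' S))
    {n : ℕ} (hn : PowerSeries.coeff n (f : k⟦X⟧) ≠ 0) :
    ∃ e ∈ exponentSet (Ideal.span (monomialOf k '' S)), ∃ p ∈ H, p ≠ 0 ∧ e + p = n := by
  induction hf using Submodule.mul_induction_on' generalizing n with
  | mem_mul_mem r hr x hx =>
    change PowerSeries.coeff n ((r : k⟦X⟧) * (x : k⟦X⟧)) ≠ 0 at hn
    rw [PowerSeries.coeff_mul] at hn
    obtain ⟨p, hp, hne⟩ := Finset.exists_ne_zero_of_sum_ne_zero hn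
    have hr0 := left_ne_zero_of_mul hne
    refine ⟨p.2, (mem_span_monomialOf_iff_exponentSet hC).mp hx _ (right_ne_zero_of_mul hne),
      p.1, r.2 _ hr0, fun h0 => hr0 ?_, ?_⟩
    · rw [h0]
      exact mem_maximalIdeal_semigroupRing_iff.mp hr
    · have := Finset.HasAntidiagonal.mem_antidiagonal.mp hp
      omega
  | add x _ y _ ihx ihy =>
    by_cases hx : PowerSeries.coeff n (x : k⟦X⟧) = 0
    · refine ihy fun hy => hn ?_
      change PowerSeries.coeff n ((x : k⟦X⟧) + (y : k⟦X⟧)) = 0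
      rw [map_add, hx, hy, add_zero]
    · exact ihx hx

/-- A principal reduction of a monomial ideal has the order of the least exponent `a`, so that
`E + E = a + E` for the set `E` of the exponents of the ideal. -/
theorem exists_add_eq_of_sq_eq_span_singleton_mul {C : ℕ} (hC : ∀ n ≥ C, n ∈ H) {S : Set H}
    {I : Ideal (semigroupRing k H)} (hI : I = Ideal.span (monomialOf k '' S))
    {f : semigroupRing k H} (hf : f ∈ I) (hsq : I ^ 2 = Ideal.span {f} * I) {a : ℕ}
    (ha : IsLeast (exponentSet I) a) {e e' : ℕ} (he : e ∈ exponentSet I)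
    (he' : e' ∈ exponentSet I) : ∃ e'' ∈ exponentSet I, e + e' = a + e'' := by
  have hexp : ∀ g ∈ I, ∀ n, PowerSeries.coeff n (g : k⟦X⟧) ≠ 0 → n ∈ exponentSet I := by
    subst hI
    exact fun g hg => (mem_span_monomialOf_iff_exponentSet hC).mp hg
  have key : ∀ e ∈ exponentSet I, ∀ e' ∈ exponentSet I,
      (f : k⟦X⟧).order.toNat ∈ exponentSet I ∧
        ∃ e'' ∈ exponentSet I, (f : k⟦X⟧).order.toNat + e'' = e + e' := by
    rintro _ ⟨e, rfl, he⟩ _ ⟨e', rfl, he'⟩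
    have hmem : monomialOf k (e + e') ∈ I ^ 2 := by
      rw [pow_two, monomialOf_add]
      exact Ideal.mul_mem_mul he he'
    rw [hsq] at hmem
    obtain ⟨g, hg, hfg⟩ := Ideal.mem_span_singleton_mul.mp hmem
    obtain ⟨h1, h2, h3⟩ := exists_coeff_ne_zero_of_mul_eq_X_pow (congrArg Subtype.val hfg)
    exact ⟨hexp f hf _ h1, _, hexp g hg _ h2, h3⟩
  obtain ⟨hp, e₀, he₀, h0⟩ := key a ha.1 a ha.1
  have h1 := ha.2 hp
  have h2 := ha.2 he₀
  obtain ⟨-, e'', he'', h3⟩ := key e he e' he'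
  exact ⟨e'', he'', by omega⟩

/-- The exponents of a monomial Ulrich ideal satisfy the relation condition of
`exists_generator_of_semigroupIdeal`, because the least monomial and any further minimal generator
are part of a basis of `I / I ^ 2`. -/
theorem mem_exponentSet_of_add_eq_add {C : ℕ} (hC : ∀ n ≥ C, n ∈ H) {S : Set H}
    {I : Ideal (semigroupRing k H)} (hI : I = Ideal.span (monomialOf k '' S))
    (hle : I ≤ IsLocalRing.maximalIdeal (semigroupRing k H))
    (hfree : Module.Free (semigroupRing k H ⧸ I) I.Cotangent) {a : ℕ}
    (ha : IsLeast (exponentSet I) a) {s : ℕ} (hs : s ∈ exponentSet I)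
    (hsa : ∀ h ∈ H, a + h ≠ s)
    (hsmin : ∀ e ∈ exponentSet I, ∀ p ∈ H, p ≠ 0 → e + p ≠ s) {h h' : ℕ} (hh : h ∈ H)
    (hh' : h' ∈ H) (heq : h + s = h' + a) : h ∈ exponentSet I := by
  have hmI : ∀ g ∈ IsLocalRing.maximalIdeal (semigroupRing k H) * I, ∀ n,
      PowerSeries.coeff n (g : k⟦X⟧) ≠ 0 →
        ∃ e ∈ exponentSet I, ∃ p ∈ H, p ≠ 0 ∧ e + p = n := by
    subst hI
    exact fun g hg n hn => exists_add_eq_of_mem_maximalIdeal_mul hC hg hn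
  obtain ⟨⟨a, rfl, haI⟩, hmin⟩ := ha
  obtain ⟨s, rfl, hsI⟩ := hs
  refine ⟨⟨h, hh⟩, rfl, mem_of_mul_eq_mul_of_free_cotangent hle haI hsI (q := monomialOf k ⟨h', hh'⟩)
    (fun hx => ?_) (fun w hw => ?_) ?_⟩
  · obtain ⟨e, he, p, hp, hp0, hep⟩ := hmI _ hx a (by simp [coe_monomialOf])
    have := hmin he
    omega
  · obtain ⟨e, he, p, hp, hp0, hep⟩ := hmI _ hw s (by
      change PowerSeries.coeff (s : ℕ) (PowerSeries.X ^ (s : ℕ) -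
        (w : k⟦X⟧) * PowerSeries.X ^ (a : ℕ)) ≠ 0
      rw [map_sub, PowerSeries.coeff_X_pow_self, PowerSeries.coeff_mul_X_pow']
      split_ifs with hle
      · have hw0 : PowerSeries.coeff ((s : ℕ) - a) (w : k⟦X⟧) = 0 := by
          by_contra hne
          exact hsa _ (w.2 _ hne) (Nat.add_sub_cancel' hle)
        rw [hw0, sub_zero]
        exact one_ne_zero
      · rw [sub_zero]
        exact one_ne_zero)
    exact hsmin e he p hp hp0 hep
  · rw [← monomialOf_add, ← monomialOf_add]
    congr 1
    exact Subtype.ext heq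

/-- The generators of a monomial Ulrich ideal of a Gorenstein semigroup ring. -/
theorem exists_generators_of_mem_monomialUlrichIdeals {C : ℕ} (hC : ∀ n ≥ C, n ∈ H)
    (hH : IsSymmetricSemigroup H) {I : Ideal (semigroupRing k H)}
    (hI : I ∈ monomialUlrichIdeals k H) :
    ∃ a b : H, (a : ℕ) < b ∧ I = Ideal.span {monomialOf k a, monomialOf k b} ∧
      ((b - a : ℕ) ∉ H ∧ 2 * (b - a : ℕ) ∈ H) ∧
      IsSymmetricSemigroup (H ⊔ AddSubmonoid.closure {(b - a : ℕ)}) ∧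
      IsLeast {h : ℕ | h ∈ H ∧ h + (b - a : ℕ) ∈ H} a := by
  classical
  obtain ⟨hU, hnpar, S, hIS⟩ := hI
  have hle : I ≤ IsLocalRing.maximalIdeal (semigroupRing k H) :=
    hU.radical_eq ▸ Ideal.le_radical
  have hmem : ∀ {f}, f ∈ I ↔ ∀ n, PowerSeries.coeff n (f : k⟦X⟧) ≠ 0 → n ∈ exponentSet I := by
    subst hIS
    exact mem_span_monomialOf_iff_exponentSet hC
  obtain ⟨Q, hQ, hQI, hsq⟩ := hU.exists_reduction
  obtain ⟨⟨f, rfl⟩, -⟩ := (isParameterIdeal_semigroupRing_iff hC).mp hQ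
  have hfI : f ∈ I := hQI (Ideal.mem_span_singleton_self f)
  have hne : ∃ n, n ∈ exponentSet I := by
    by_contra! hcon
    have hbot : I = ⊥ := (Submodule.eq_bot_iff _).mpr fun g hg => by
      refine Subtype.ext (PowerSeries.ext fun n => ?_)
      by_contra hn
      exact hcon n (hmem.mp hg n hn)
    refine hnpar ((isParameterIdeal_semigroupRing_iff hC).mpr ⟨⟨0, ?_⟩, hU.radical_eq⟩)
    rw [hbot, Ideal.span_singleton_zero]
  have ha : IsLeast (exponentSet I) (Nat.find hne) :=
    ⟨Nat.find_spec hne, fun n hn => Nat.find_min' hne hn⟩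
  generalize Nat.find hne = a at ha
  have hE0 : 0 ∉ exponentSet I := by
    rintro ⟨h, h0, hh⟩
    have := mem_maximalIdeal_semigroupRing_iff.mp (hle hh)
    rw [coe_monomialOf, h0, pow_zero, PowerSeries.coeff_zero_one] at this
    exact one_ne_zero this
  have hEH : ∀ e ∈ exponentSet I, e ∈ H := by
    rintro _ ⟨h, rfl, -⟩
    exact h.2
  obtain ⟨a', haa', haI⟩ := id ha.1
  have hnp : ∃ e ∈ exponentSet I, ∀ h ∈ H, a + h ≠ e := by
    by_contra! hcon
    refine hnpar ((isParameterIdeal_semigroupRing_iff hC).mpr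
      ⟨⟨monomialOf k a', le_antisymm (fun g hg => ?_) ?_⟩, hU.radical_eq⟩)
    · rw [← Set.image_singleton, mem_span_monomialOf_iff hC]
      intro n hn
      obtain ⟨h, hh, hn'⟩ := hcon n (hmem.mp hg n hn)
      exact ⟨a', rfl, ⟨h, hh⟩, by rw [haa']; exact hn'⟩
    · exact (Ideal.span_singleton_le_iff_mem I).mpr haI
  obtain ⟨b, hbE, hab, hcover, h1, h2, h3, h4⟩ := exists_generator_of_semigroupIdeal hC hH hE0 hEH
    (fun e he h hh => add_mem_exponentSet he hh) ha
    (fun e he e' he' => exists_add_eq_of_sq_eq_span_singleton_mul hC hIS hfI hsq ha he he')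
    (fun s hs hsa hsmin h hh h' hh' heq => mem_exponentSet_of_add_eq_add hC hIS hle hU.free ha hs
      hsa hsmin hh hh' heq) hnp
  obtain ⟨b, rfl, hbI⟩ := hbE
  subst haa'
  refine ⟨a', b, hab, le_antisymm (fun g hg => ?_) ?_, ⟨h1, h2⟩, h3, h4⟩
  · rw [← Set.image_pair, mem_span_monomialOf_iff hC]
    intro n hn
    rcases hcover n (hmem.mp hg n hn) with ⟨h, hh, rfl⟩ | ⟨h, hh, rfl⟩
    · exact ⟨a', by simp, ⟨h, hh⟩, rfl⟩
    · exact ⟨b, by simp, ⟨h, hh⟩, rfl⟩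
  · rw [Ideal.span_le]
    rintro _ (rfl | rfl)
    · exact haI
    · exact hbI

/-- Conversely, the ideals `(t ^ a, t ^ b)` with `c = b - a` as in the classification are Ulrich. -/
theorem span_pair_mem_monomialUlrichIdeals {C : ℕ} (hC : ∀ n ≥ C, n ∈ H)
    (hH : IsSymmetricSemigroup H) {a b : H} {c : ℕ} (hb : (b : ℕ) = a + c) (hcH : c ∉ H)
    (hc2 : 2 * c ∈ H) (hK : IsSymmetricSemigroup (H ⊔ AddSubmonoid.closure {c}))
    (ha : IsLeast {h : ℕ | h ∈ H ∧ h + c ∈ H} a) :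
    Ideal.span {monomialOf k a, monomialOf k b} ∈ monomialUlrichIdeals k H := by
  obtain ⟨I, hI⟩ : ∃ I, I = Ideal.span {monomialOf k a, monomialOf k b} := ⟨_, rfl⟩
  rw [← hI]
  -- the exponents of `I` form the set `H ∩ (H - c)`
  have hmem : ∀ {f}, f ∈ I ↔ ∀ n, PowerSeries.coeff n (f : k⟦X⟧) ≠ 0 → n ∈ H ∧ n + c ∈ H := by
    intro f
    rw [hI, ← Set.image_pair, mem_span_monomialOf_iff hC]
    refine forall_congr' fun n => imp_congr_right fun _ => ?_
    have hD := (isSymmetricSemigroup_sup_closure_iff hH hc2 ha).mp hK n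
    rw [isExponent_sup_closure_iff hc2, isExponent_natCast,
      show (n : ℤ) + c = ((n + c : ℕ) : ℤ) by push_cast; rfl, isExponent_natCast] at hD
    rw [hD]
    constructor
    · rintro ⟨s, rfl | rfl, h, rfl⟩
      · exact Or.inl ⟨h, h.2, by push_cast; ring⟩
      · exact Or.inr ⟨h, h.2, by rw [hb]; push_cast; ring⟩
    · rintro (⟨h, hh, hz⟩ | ⟨h, hh, hz⟩)
      · exact ⟨a, by simp, ⟨h, hh⟩, by dsimp only; omega⟩
      · exact ⟨b, by simp, ⟨h, hh⟩, by dsimp only; omega⟩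
  have haI : monomialOf k a ∈ I := hI ▸ Ideal.subset_span (by simp)
  have hbI : monomialOf k b ∈ I := hI ▸ Ideal.subset_span (by simp)
  have ha0 : (a : ℕ) ≠ 0 := fun h0 => hcH (by simpa [h0] using ha.1.2)
  have hle : I ≤ IsLocalRing.maximalIdeal (semigroupRing k H) := by
    intro f hf
    rw [mem_maximalIdeal_semigroupRing_iff]
    by_contra h0
    have := ha.2 (hmem.mp hf 0 h0)
    omega
  have hrad := radical_eq_maximalIdeal hC hle haI (monomialOf_ne_zero a)
  have hsq : I ^ 2 = Ideal.span {monomialOf k a} * I := by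
    refine le_antisymm ?_ ?_
    · rw [pow_two]
      nth_rw 1 [hI]
      rw [Ideal.span_insert, Ideal.sup_mul, sup_le_iff]
      refine ⟨le_rfl, ?_⟩
      nth_rw 1 [hI]
      rw [Ideal.span_singleton_mul_le_iff]
      intro z hz
      obtain ⟨p, q, rfl⟩ := Ideal.mem_span_pair.mp hz
      rw [mul_add]
      refine add_mem ?_ ?_
      · rw [show monomialOf k b * (p * monomialOf k a) = monomialOf k a * (p * monomialOf k b) by
          ring]
        exact Ideal.mul_mem_mul (Ideal.mem_span_singleton_self _) (Ideal.mul_mem_left _ _ hbI)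
      · have e : b + b = a + (a + ⟨2 * c, hc2⟩) := Subtype.ext (by
          push_cast
          omega)
        rw [mul_left_comm, ← monomialOf_add, e, monomialOf_add, mul_left_comm]
        refine Ideal.mul_mem_mul (Ideal.mem_span_singleton_self _) (Ideal.mul_mem_left _ _ ?_)
        rw [monomialOf_add]
        exact Ideal.mul_mem_right _ _ haI
    · rw [pow_two]
      exact Ideal.mul_mono_left ((Ideal.span_singleton_le_iff_mem I).mpr haI)
  refine ⟨⟨hrad, ⟨_, (isParameterIdeal_semigroupRing_iff hC).mpr ⟨⟨_, rfl⟩, ?_⟩,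
    (Ideal.span_singleton_le_iff_mem I).mpr haI, hsq⟩, ?_⟩, fun hpar => ?_, {a, b}, ?_⟩
  · exact radical_eq_maximalIdeal hC (((Ideal.span_singleton_le_iff_mem I).mpr haI).trans hle)
      (Ideal.mem_span_singleton_self _) (monomialOf_ne_zero a)
  · refine free_cotangent_of_span_pair hI fun p q hpq => ?_
    rw [hsq] at hpq
    obtain ⟨i, hi, hipq⟩ := Ideal.mem_span_singleton_mul.mp hpq
    -- cancelling `t ^ a` leaves `p + q t ^ c = i ∈ I`
    have key : p.1 + q.1 * PowerSeries.X ^ c = i.1 := by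
      have h : PowerSeries.X ^ (a : ℕ) * i.1 =
          p.1 * PowerSeries.X ^ (a : ℕ) + q.1 * PowerSeries.X ^ (b : ℕ) :=
        congrArg Subtype.val hipq
      refine mul_left_cancel₀ (pow_ne_zero (a : ℕ) PowerSeries.X_ne_zero) (h.trans ?_).symm
      rw [hb, pow_add]
      ring
    have hcoeff : ∀ n, PowerSeries.coeff n p.1 + PowerSeries.coeff n (q.1 * PowerSeries.X ^ c) =
        PowerSeries.coeff n i.1 := fun n => by rw [← map_add, key]
    have hq : q ∈ I := by
      refine hmem.mpr fun n hn => ⟨q.2 n hn, ?_⟩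
      have h := hcoeff (n + c)
      rw [PowerSeries.coeff_mul_X_pow] at h
      by_contra hnc
      have hp0 : PowerSeries.coeff (n + c) p.1 = 0 := by
        by_contra hne
        exact hnc (p.2 _ hne)
      have hi0 : PowerSeries.coeff (n + c) i.1 = 0 := by
        by_contra hne
        exact hnc (i.2 _ hne)
      rw [hp0, hi0, zero_add] at h
      exact hn h
    refine ⟨hmem.mpr fun n hn => ?_, hq⟩
    by_cases hi0 : PowerSeries.coeff n i.1 = 0
    · have h := hcoeff n
      rw [hi0, PowerSeries.coeff_mul_X_pow'] at h
      split_ifs at h with hcn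
      · have hq0 : PowerSeries.coeff (n - c) q.1 ≠ 0 := fun h0 => hn (by
          rwa [h0, add_zero] at h)
        obtain ⟨h1, h2⟩ := hmem.mp hq _ hq0
        refine ⟨by rwa [Nat.sub_add_cancel hcn] at h2, ?_⟩
        rw [show n + c = n - c + 2 * c by omega]
        exact H.add_mem h1 hc2
      · exact absurd (by rwa [add_zero] at h) hn
    · exact hmem.mp hi n hi0
  · -- the order of a generator would be `a`, and `t ^ b` would be a multiple of it
    obtain ⟨⟨f, hf⟩, -⟩ := (isParameterIdeal_semigroupRing_iff hC).mp hpar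
    obtain ⟨u, hu⟩ := Ideal.mem_span_singleton.mp (hf ▸ haI)
    obtain ⟨v, hv⟩ := Ideal.mem_span_singleton.mp (hf ▸ hbI)
    obtain ⟨h1, -, h2⟩ := exists_coeff_ne_zero_of_mul_eq_X_pow (congrArg Subtype.val hu).symm
    obtain ⟨-, h3, h4⟩ := exists_coeff_ne_zero_of_mul_eq_X_pow (congrArg Subtype.val hv).symm
    have h5 := ha.2 (hmem.mp (hf ▸ Ideal.mem_span_singleton_self f) _ h1)
    refine hcH ?_
    have h6 := v.2 _ h3
    change (f : k⟦X⟧).order.toNat + (u : k⟦X⟧).order.toNat = a at h2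
    change (f : k⟦X⟧).order.toNat + (v : k⟦X⟧).order.toNat = b at h4
    rwa [show (v : k⟦X⟧).order.toNat = c by omega] at h6
  · rw [hI, Set.image_pair]

end Ulrich

/-! ### The classification -/

theorem exists_forall_ge_mem_semigroupOf {ℓ : ℕ} (g : Fin ℓ → ℕ)
    (hgcd : Finset.univ.gcd g = 1) : ∃ C, ∀ n ≥ C, n ∈ semigroupOf g := by
  obtain ⟨C, hC⟩ := Nat.exists_mem_closure_of_ge (Set.range g)
  refine ⟨C, fun n hn => hC n hn ?_⟩
  have h1 : Nat.setGcd (Set.range g) ∣ 1 := by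
    rw [← hgcd]
    exact Finset.dvd_gcd fun i _ => Nat.setGcd_dvd_of_mem ⟨i, rfl⟩
  exact h1.trans (one_dvd n)

theorem theorem6p4 {k : Type*} [Field k] {ℓ : ℕ} (g : Fin ℓ → ℕ) (hpos : ∀ i, 0 < g i)
    (hgcd : Finset.univ.gcd g = 1)
    (hGor : IsGorensteinLocalRing (semigroupRing k (semigroupOf g)))
    (I : Ideal (semigroupRing k (semigroupOf g))) :
    I ∈ monomialUlrichIdeals k (semigroupOf g) ↔
      ∃ a b : semigroupOf g, (a : ℕ) < b ∧ I = Ideal.span {monomialOf k a, monomialOf k b} ∧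
        ∃ c : ℕ, c = (b : ℕ) - a ∧
          (c ∉ semigroupOf g ∧ 2 * c ∈ semigroupOf g) ∧
          IsSymmetricSemigroup (semigroupOf g ⊔ AddSubmonoid.closure {c}) ∧
          IsLeast {h : ℕ | h ∈ semigroupOf g ∧ h + c ∈ semigroupOf g} a := by
  obtain ⟨C, hC⟩ := exists_forall_ge_mem_semigroupOf g hgcd
  have hH := isSymmetricSemigroup_of_isGorensteinLocalRing hC hGor
  constructor
  · intro hI
    obtain ⟨a, b, hab, hspan, hc⟩ := exists_generators_of_mem_monomialUlrichIdeals hC hH hI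
    exact ⟨a, b, hab, hspan, _, rfl, hc⟩
  · rintro ⟨a, b, hab, rfl, c, hc, ⟨hcH, hc2⟩, hK, ha⟩
    exact span_pair_mem_monomialUlrichIdeals hC hH (by omega) hcH hc2 hK ha
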